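/- Theorem. Let $G$ be a finite maximal planar graph, i.e. a finite simple planar graph to which no edge between two non-adjacent vertices can be added without destroying planarity, and fix any embedding of $G$ in the sphere. Call a coloring $c$ of the vertices of $G$ with four colors a *regular 4-coloring* (R4-coloring) if every edge $uv$ lies on two triangular faces $uvw$ and $uvw'$, one on each side of it, and the four colors $c(u),c(v),c(w),c(w')$ are pairwise distinct; that is, the vertices of each triangular face have three different colors, and the vertex $w'$ obtained by mirroring $w$ in the edge $uv$ has the fourth color. Then $G$ has a regular 4-coloring if and only if the degree of every vertex of $G$ is a multiple of $3$. -/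

import Mathlib

/-- A rotation system of a simple graph: a permutation of the darts (oriented edges) whose cycles
are exactly the sets of darts leaving a common vertex, i.e. a cyclic order of the darts around
every vertex.  A rotation system of a finite graph is the combinatorial description (up to
orientation-preserving homeomorphism) of a cellular embedding of each connected component in a
closed oriented surface. -/
structure RotationSystem {V : Type*} (G : SimpleGraph V) where
  /-- the next dart around the initial vertex -/
  rot : Equiv.Perm G.Dart
  rot_fst : ∀ d : G.Dart, (rot d).fst = d.fst
  rot_sameCycle : ∀ d d' : G.Dart, d.fst = d'.fst → rot.SameCycle d d'

namespace RotationSystem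

/-- The next dart along the boundary of the face lying beside a dart: the dart `u → v` is followed
by the dart that comes next after `v → u` in the rotation at `v`. -/
def faceNext {V : Type*} {G : SimpleGraph V} (R : RotationSystem G) : Equiv.Perm G.Dart :=
  (Function.Involutive.toPerm SimpleGraph.Dart.symm SimpleGraph.Dart.symm_involutive).trans R.rot

/-- The faces that are bounded by at least one edge: the cycles of `faceNext`
(fixed points, if any, count as cycles). -/
def Face {V : Type*} {G : SimpleGraph V} (R : RotationSystem G) : Type _ :=
  Quotient (Equiv.Perm.SameCycle.setoid R.faceNext)

/-- The number of faces, each connected component being drawn on a surface of its own.  An isolated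
vertex has no darts, and its sphere has one face. -/
noncomputable def numFaces {V : Type*} {G : SimpleGraph V} (R : RotationSystem G) : ℕ :=
  Nat.card R.Face + Nat.card {v : V // ∀ w, ¬ G.Adj v w}

/-- The rotation system describes embeddings in the sphere: Euler's formula `V - E + F = 2 C`.
As `V - E + F ≤ 2` for each of the `C` components, the formula holds exactly if it holds
with `C = 1` for every component, i.e. if every component has genus `0`. -/
def IsSpherical {V : Type*} [Finite V] {G : SimpleGraph V} (R : RotationSystem G) : Prop :=
  Nat.card V + R.numFaces = Nat.card G.edgeSet + 2 * Nat.card G.ConnectedComponent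

/-- The vertex that follows the dart `d` on the boundary of the face beside `d`;
if this face is a triangle, then it is the vertex of the triangle opposite to `d`. -/
def apex {V : Type*} {G : SimpleGraph V} (R : RotationSystem G) (d : G.Dart) : V :=
  (R.faceNext d).snd

/-- A regular 4-coloring (R4-coloring): all faces are triangles, each triangle `u v w` has three
colors, and the vertex `w'` of the triangle `v u w'` on the other side of the edge `u v` (the mirror
image of `w` in that edge) has the fourth color. -/
structure IsR4Coloring {V : Type*} {G : SimpleGraph V} (R : RotationSystem G) (c : V → Fin 4) :
    Prop where
  triangular : ∀ d : G.Dart, R.faceNext (R.faceNext (R.faceNext d)) = d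
  distinct : ∀ d : G.Dart,
    Function.Injective ![c d.fst, c d.snd, c (R.apex d), c (R.apex d.symm)]

/-- There is a regular 4-coloring of the vertices of the embedded graph. -/
def R4Colorable {V : Type*} {G : SimpleGraph V} (R : RotationSystem G) : Prop :=
  ∃ c : V → Fin 4, R.IsR4Coloring c

end RotationSystem

/-- A finite simple graph is planar if it has an embedding in the sphere. -/
def IsPlanar {V : Type*} [Finite V] (G : SimpleGraph V) : Prop :=
  ∃ R : RotationSystem G, R.IsSpherical

/-- A finite simple graph is maximal planar if it is planar and no edges can be added (on the same
vertex set) so that it stays planar (`≤` is inclusion of the edge sets). -/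
def IsMaximalPlanar {V : Type*} [Finite V] (G : SimpleGraph V) : Prop :=
  Maximal IsPlanar G

/-! Around a vertex of an R4-coloring, each neighbor's color is determined by the two preceding
ones, and the three colors other than the center's recur with period exactly 3; so 3 divides the
degree.

Conversely, record the colors of u, v, w, w' at a dart u → v as a permutation of `Fin 4`. Reversing
the dart multiplies it by an involution τ, moving along a triangle by a 3-cycle κ, turning around u
by τκ, which has order 3. If all faces are triangles and all degrees are multiples of 3, this rule
has trivial monodromy around faces and vertices, so it defines a covering of the map with fiber the
symmetric group. On a sphere every covering is trivial (`Equiv.Perm.IsCovering.exists_section`), and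
a section is the coloring.

Triviality is obtained by counting. A covering with n sheets multiplies the numbers of vertices,
edges and faces by n; as the genus upstairs is nonnegative (`Equiv.Perm.card_cycles_add_le`), it has
at least n components over each component below, hence exactly n.

That all faces are triangles comes from maximality. Consecutive vertices a, b, c, e of a face
satisfy a ~ c and b ~ e, or else a chord could be added. If e ≠ a, the triangle abc would separate
the edge be from itself. The two sides of a triangle come from a covering too, now with fiber `ZMod
2`. -/

open Equiv

/-! ### Nonnegativity of the genus by linear algebra -/

/-- The real functions that are constant on the classes of a setoid. -/
def Setoid.invariantFunctions {D : Type*} (s : Setoid D) : Submodule ℝ (D → ℝ) where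
  carrier := {f | ∀ a b, s a b → f a = f b}
  add_mem' hf hg a b h := by simp [hf a b h, hg a b h]
  zero_mem' a b _ := rfl
  smul_mem' r f hf a b h := by simp [hf a b h]

/-- Turns numbers of cycles and of components into dimensions. -/
theorem Setoid.finrank_invariantFunctions {D : Type*} [Finite D] (s : Setoid D) :
    Module.finrank ℝ s.invariantFunctions = Nat.card (Quotient s) := by
  classical
  have := Fintype.ofFinite (Quotient s)
  have hinj : Function.Injective (LinearMap.funLeft ℝ ℝ (Quotient.mk s)) :=
    LinearMap.funLeft_injective_of_surjective ℝ ℝ _ Quotient.mk_surjective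
  have hrange : LinearMap.range (LinearMap.funLeft ℝ ℝ (Quotient.mk s)) = s.invariantFunctions := by
    ext f
    constructor
    · rintro ⟨g, rfl⟩ a b h
      simp only [LinearMap.funLeft_apply]
      rw [Quotient.sound h]
    · intro hf
      exact ⟨Quotient.lift f hf, rfl⟩
  rw [← hrange, LinearMap.finrank_range_of_inj hinj, Module.finrank_fintype_fun_eq_card,
    Nat.card_eq_fintype_card]

theorem Equiv.Perm.SameCycle.apply_eq {D Y : Type*} {σ : Perm D} {f : D → Y}
    (h : ∀ d, f (σ d) = f d) {a b : D} (hab : σ.SameCycle a b) : f a = f b := by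
  obtain ⟨i, rfl⟩ := hab
  induction i using Int.induction_on with
  | zero => simp
  | succ i ih => rw [add_comm, zpow_add, zpow_one, Perm.mul_apply, h, ← ih]
  | pred i ih =>
    rw [sub_eq_neg_add, zpow_add, Perm.mul_apply, ih, ← h ((σ ^ (-1 : ℤ)) _)]
    simp

theorem Equiv.Perm.mem_invariantFunctions_sameCycle {D : Type*} {σ : Perm D} {f : D → ℝ} :
    f ∈ (Perm.SameCycle.setoid σ).invariantFunctions ↔ ∀ d, f (σ d) = f d :=
  ⟨fun h d => (h d (σ d) ⟨1, by simp⟩).symm, fun h _ _ hab => Perm.SameCycle.apply_eq h hab⟩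

theorem Setoid.mem_invariantFunctions_sup {D : Type*} {s t : Setoid D} {f : D → ℝ} :
    f ∈ (s ⊔ t).invariantFunctions ↔ f ∈ s.invariantFunctions ∧ f ∈ t.invariantFunctions := by
  have key (r : Setoid D) : f ∈ r.invariantFunctions ↔ r ≤ Setoid.ker f :=
    ⟨fun h a b hab => h a b hab, fun h a b hab => h hab⟩
  rw [key, key, key, sup_le_iff]

theorem Submodule.finrank_le_finrank_map_add {K M N : Type*} [Field K] [AddCommGroup M] [Module K M]
    [AddCommGroup N] [Module K N] [FiniteDimensional K M] (T : M →ₗ[K] N) (U W : Submodule K M)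
    (h : ∀ u ∈ U, T u = 0 → u ∈ W) :
    Module.finrank K U ≤ Module.finrank K (U.map T) + Module.finrank K W := by
  have h1 := LinearMap.finrank_range_add_finrank_ker (T.domRestrict U)
  rw [LinearMap.range_domRestrict] at h1
  have h2 : Module.finrank K (LinearMap.ker (T.domRestrict U)) ≤ Module.finrank K W := by
    refine LinearMap.finrank_le_finrank_of_injective
      (f := (U.subtype ∘ₗ (LinearMap.ker (T.domRestrict U)).subtype).codRestrict W ?_) ?_
    · rintro ⟨⟨u, hu⟩, hx⟩
      exact h u hu (by simpa using hx)
    · rw [LinearMap.injective_codRestrict_iff]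
      exact U.injective_subtype.comp (Submodule.injective_subtype _)
  omega

/-- The genus of a combinatorial map is nonnegative. -/
theorem Equiv.Perm.card_cycles_add_le {D : Type*} [Finite D] (σ α : Perm D)
    (hα : ∀ d, α (α d) = d) :
    Nat.card (Quotient (Perm.SameCycle.setoid σ)) +
        Nat.card (Quotient (Perm.SameCycle.setoid (σ * α))) +
        Nat.card (Quotient (Perm.SameCycle.setoid α)) ≤
      Nat.card D +
        2 * Nat.card (Quotient (Perm.SameCycle.setoid σ ⊔ Perm.SameCycle.setoid α)) := by
  classical
  have := Fintype.ofFinite D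
  simp only [← Setoid.finrank_invariantFunctions]
  -- `T` is a coboundary map. On `U` and on `W` its kernel consists of functions constant on
  -- components; the images are orthogonal in the range of `T`, whose dimension is `Nat.card D`
  -- minus the number of cycles of `α`.
  let T : (D → ℝ) →ₗ[ℝ] (D → ℝ) := LinearMap.funLeft ℝ ℝ α - LinearMap.id
  have hT (f : D → ℝ) (d : D) : T f d = f (α d) - f d := rfl
  have hT0 {f : D → ℝ} (hf : T f = 0) : f ∈ (Perm.SameCycle.setoid α).invariantFunctions :=
    Perm.mem_invariantFunctions_sameCycle.2 fun d => sub_eq_zero.1 (congrFun hf d)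
  set U := (Perm.SameCycle.setoid σ).invariantFunctions
  set W := (Perm.SameCycle.setoid (σ * α)).invariantFunctions
  set A := (Perm.SameCycle.setoid α).invariantFunctions
  have hU := Submodule.finrank_le_finrank_map_add T U
    (Perm.SameCycle.setoid σ ⊔ Perm.SameCycle.setoid α).invariantFunctions
    fun u hu h0 => Setoid.mem_invariantFunctions_sup.2 ⟨hu, hT0 h0⟩
  have hW := Submodule.finrank_le_finrank_map_add T W
    (Perm.SameCycle.setoid σ ⊔ Perm.SameCycle.setoid α).invariantFunctions
    fun u hu h0 => by
      refine Setoid.mem_invariantFunctions_sup.2 ⟨?_, hT0 h0⟩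
      rw [Perm.mem_invariantFunctions_sameCycle] at hu ⊢
      intro d
      have h1 := hu (α d)
      rw [Perm.mul_apply, hα] at h1
      rw [h1, Perm.mem_invariantFunctions_sameCycle.1 (hT0 h0)]
  have horth : U.map T ⊓ W.map T = ⊥ := by
    rw [Submodule.eq_bot_iff]
    rintro x ⟨⟨f, hf, rfl⟩, ⟨g, hg, hfg⟩⟩
    rw [SetLike.mem_coe, Perm.mem_invariantFunctions_sameCycle] at hf hg
    rw [← dotProduct_self_eq_zero (R := ℝ)]
    nth_rewrite 2 [← hfg]
    simp only [dotProduct, hT, sub_mul, mul_sub, Finset.sum_sub_distrib]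
    have e1 : ∑ d, f (α d) * g (α d) = ∑ d, f d * g d :=
      Equiv.sum_comp α fun d => f d * g d
    -- Reindex by `σ * α`: `f` is `σ`-invariant and `g` is `σ * α`-invariant.
    have e2 : ∑ d, f (α d) * g d = ∑ d, f d * g d := by
      rw [← Equiv.sum_comp σ fun d => f d * g d, ← Equiv.sum_comp α fun d => f (σ d) * g (σ d)]
      refine Finset.sum_congr rfl fun d _ => ?_
      rw [hf, ← hg d, Perm.mul_apply]
    have e3 : ∑ d, f d * g (α d) = ∑ d, f d * g d := by
      rw [← e2, ← Equiv.sum_comp α fun d => f d * g (α d)]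
      simp [hα]
    rw [e1, e2, e3]
    ring
  have hsup := Submodule.finrank_sup_add_finrank_inf_eq (U.map T) (W.map T)
  rw [horth, finrank_bot] at hsup
  have hle : Module.finrank ℝ (U.map T ⊔ W.map T : Submodule ℝ (D → ℝ)) ≤
      Module.finrank ℝ (LinearMap.range T) :=
    Submodule.finrank_mono (sup_le (LinearMap.map_le_range) (LinearMap.map_le_range))
  have hrk := LinearMap.finrank_range_add_finrank_ker T
  have hker : LinearMap.ker T = A := by
    ext f
    refine ⟨hT0, fun hf => ?_⟩
    funext d
    rw [hT, Perm.mem_invariantFunctions_sameCycle.1 hf, sub_self, Pi.zero_apply]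
  rw [hker, Module.finrank_fintype_fun_eq_card, ← Nat.card_eq_fintype_card] at hrk
  omega

/-! ### Coverings of combinatorial maps -/

section Covering

variable {D X : Type*}

theorem Equiv.Perm.zpow_fst_of_semiconj {σ : Perm D} {σ' : Perm (D × X)}
    (h : ∀ z, (σ' z).1 = σ z.1) (k : ℤ) (z : D × X) : ((σ' ^ k) z).1 = (σ ^ k) z.1 := by
  have hinv (z : D × X) : (σ'⁻¹ z).1 = σ⁻¹ z.1 := by
    rw [Perm.eq_inv_iff_eq, ← h]; simp
  induction k using Int.induction_on generalizing z with
  | zero => simp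
  | succ i ih => rw [zpow_add, zpow_add, Perm.mul_apply, Perm.mul_apply, ih]; simp [h]
  | pred i ih =>
    rw [sub_eq_add_neg, zpow_add, zpow_add, Perm.mul_apply, Perm.mul_apply, ih,
      zpow_neg_one, zpow_neg_one, hinv]

/-- The permutation `σ'` of `D × X` lifts `σ`, and every cycle of `σ'` is mapped bijectively onto a
cycle of `σ`. -/
structure Equiv.Perm.IsCovering (σ : Perm D) (σ' : Perm (D × X)) : Prop where
  fst_apply : ∀ z, (σ' z).1 = σ z.1
  pow_apply : ∀ (k : ℕ) z, (σ ^ k) z.1 = z.1 → (σ' ^ k) z = z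

theorem Equiv.Perm.IsCovering.zpow_apply {σ : Perm D} {σ' : Perm (D × X)}
    (h : σ.IsCovering σ') (k : ℤ) (z : D × X) (hk : (σ ^ k) z.1 = z.1) : (σ' ^ k) z = z := by
  obtain ⟨n, rfl | rfl⟩ := k.eq_nat_or_neg
  · exact h.pow_apply n z hk
  · rw [zpow_neg, Perm.inv_eq_iff_eq] at hk ⊢
    exact (h.pow_apply n z hk.symm).symm

/-- A lifted cycle closes up exactly when the cycle below does, so it meets the fiber over a chosen
representative once. -/
theorem Equiv.Perm.IsCovering.card_cycles [Finite D] [Finite X] {σ : Perm D} {σ' : Perm (D × X)}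
    (h : σ.IsCovering σ') :
    Nat.card (Quotient (Perm.SameCycle.setoid σ')) =
      Nat.card (Quotient (Perm.SameCycle.setoid σ)) * Nat.card X := by
  rw [← Nat.card_prod]
  symm
  refine Nat.card_eq_of_bijective
    (fun p : Quotient (Perm.SameCycle.setoid σ) × X =>
      (⟦(p.1.out, p.2)⟧ : Quotient (Perm.SameCycle.setoid σ'))) ⟨?_, ?_⟩
  · rintro ⟨q, x⟩ ⟨q', x'⟩ hq
    obtain ⟨k, hk⟩ : Perm.SameCycle σ' (q.out, x) (q'.out, x') := Quotient.exact hq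
    have h1 : (σ ^ k) q.out = q'.out := by
      rw [← Perm.zpow_fst_of_semiconj h.fst_apply k (q.out, x), hk]
    have h2 : q = q' := Quotient.out_equiv_out.1 ⟨k, h1⟩
    subst h2
    rw [h.zpow_apply k _ h1] at hk
    exact Prod.ext rfl (Prod.ext_iff.1 hk).2
  · intro z
    induction z using Quotient.inductionOn with
    | _ z =>
    obtain ⟨k, hk⟩ : Perm.SameCycle σ z.1 (⟦z.1⟧ : Quotient (Perm.SameCycle.setoid σ)).out :=
      (Perm.SameCycle.setoid σ).symm (Quotient.mk_out z.1)
    refine ⟨(⟦z.1⟧, ((σ' ^ k) z).2), Quotient.sound ((Perm.SameCycle.setoid σ').symm ⟨k, ?_⟩)⟩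
    rw [← hk, ← Perm.zpow_fst_of_semiconj h.fst_apply k z]

theorem Equiv.Perm.SameCycle.exists_lift {σ : Perm D} {σ' : Perm (D × X)}
    (h : ∀ z, (σ' z).1 = σ z.1) {d d' : D} (hd : σ.SameCycle d d') (x : X) :
    ∃ y, σ'.SameCycle (d, x) (d', y) := by
  obtain ⟨k, rfl⟩ := hd
  refine ⟨((σ' ^ k) (d, x)).2, k, ?_⟩
  rw [← Perm.zpow_fst_of_semiconj h k (d, x)]

/-- A covering of a combinatorial map of genus `0` is trivial, so it has sections. -/
theorem Equiv.Perm.IsCovering.exists_section [Finite D] [Finite X] [Nonempty X]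
    {σ α : Perm D} {σ' α' : Perm (D × X)}
    (hα' : ∀ z, α' (α' z) = z) (hcσ : σ.IsCovering σ') (hcα : α.IsCovering α')
    (hcφ : (σ * α).IsCovering (σ' * α'))
    (hsph : Nat.card D +
          2 * Nat.card (Quotient (Perm.SameCycle.setoid σ ⊔ Perm.SameCycle.setoid α)) ≤
        Nat.card (Quotient (Perm.SameCycle.setoid σ)) +
        Nat.card (Quotient (Perm.SameCycle.setoid (σ * α))) +
        Nat.card (Quotient (Perm.SameCycle.setoid α))) :
    ∃ h : D → X, (∀ d, σ' (d, h d) = (σ d, h (σ d))) ∧ ∀ d, α' (d, h d) = (α d, h (α d)) := by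
  classical
  set s := Perm.SameCycle.setoid σ ⊔ Perm.SameCycle.setoid α with hs
  set s' := Perm.SameCycle.setoid σ' ⊔ Perm.SameCycle.setoid α' with hs'
  have hσs' {z w : D × X} (h : σ'.SameCycle z w) : s' z w :=
    (le_sup_left : Perm.SameCycle.setoid σ' ≤ s') h
  have hαs' {z w : D × X} (h : α'.SameCycle z w) : s' z w :=
    (le_sup_right : Perm.SameCycle.setoid α' ≤ s') h
  -- The genus inequality upstairs, compared with `Nat.card X` times the Euler formula below.
  have hcard : Nat.card (Quotient s × X) ≤ Nat.card (Quotient s') := by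
    have h := Perm.card_cycles_add_le σ' α' hα'
    rw [hcσ.card_cycles, hcα.card_cycles, hcφ.card_cycles, Nat.card_prod, ← hs'] at h
    rw [Nat.card_prod]
    nlinarith [Nat.mul_le_mul_right (Nat.card X) hsph]
  have hlift {d d' : D} (hd : s d d') (x : X) : ∃ y, s' (d, x) (d', y) := by
    -- Path lifting: it suffices that the symmetrized lifting property is an equivalence relation
    -- containing the cycles of `σ` and of `α`.
    let t : Setoid D :=
      { r := fun d d' => (∀ x, ∃ y, s' (d, x) (d', y)) ∧ ∀ x, ∃ y, s' (d', x) (d, y)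
        iseqv :=
          { refl := fun d => ⟨fun x => ⟨x, s'.refl _⟩, fun x => ⟨x, s'.refl _⟩⟩
            symm := fun h => ⟨h.2, h.1⟩
            trans := fun h k =>
              ⟨fun x => (h.1 x).elim fun y hy => (k.1 y).elim fun w hw => ⟨w, s'.trans hy hw⟩,
                fun x => (k.2 x).elim fun y hy => (h.2 y).elim fun w hw => ⟨w, s'.trans hy hw⟩⟩ } }
    have hst : s ≤ t := by
      refine sup_le (fun d d' h => ?_) (fun d d' h => ?_)
      · exact ⟨fun x => (Perm.SameCycle.exists_lift hcσ.fst_apply h x).imp fun _ => hσs',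
          fun x => (Perm.SameCycle.exists_lift hcσ.fst_apply h.symm x).imp fun _ => hσs'⟩
      · exact ⟨fun x => (Perm.SameCycle.exists_lift hcα.fst_apply h x).imp fun _ => hαs',
          fun x => (Perm.SameCycle.exists_lift hcα.fst_apply h.symm x).imp fun _ => hαs'⟩
    exact (hst hd).1 x
  have huniq {d : D} {x y : X} (h : s' (d, x) (d, y)) : x = y := by
    -- Representatives of the components, chosen to include `d`. Their fibers meet every component
    -- upstairs, and by `hcard` each one only once.
    let r : Quotient s → D := Function.update Quotient.out ⟦d⟧ d
    have hr (q : Quotient s) : ⟦r q⟧ = q := by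
      by_cases hq : q = ⟦d⟧
      · subst hq; simp [r]
      · simp [r, Function.update_of_ne hq]
    have hsurj : Function.Surjective
        (fun p : Quotient s × X => (⟦(r p.1, p.2)⟧ : Quotient s')) := by
      intro z
      induction z using Quotient.inductionOn with
      | _ z =>
      obtain ⟨y, hy⟩ := hlift (s.symm (Quotient.exact (hr ⟦z.1⟧))) z.2
      exact ⟨(⟦z.1⟧, y), Quotient.sound (s'.symm hy)⟩
    have hinj := (hsurj.bijective_of_nat_card_le hcard).1
    have hd : r ⟦d⟧ = d := by simp [r]
    have := @hinj (⟦d⟧, x) (⟦d⟧, y) (Quotient.sound (by rw [hd]; exact h))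
    exact congrArg Prod.snd this
  obtain ⟨x₀⟩ := ‹Nonempty X›
  have hex (d : D) : ∃ x, s' ((⟦d⟧ : Quotient s).out, x₀) (d, x) :=
    hlift (Quotient.mk_out d) x₀
  choose h hh using hex
  refine ⟨h, fun d => ?_, fun d => ?_⟩
  · have hq : (⟦d⟧ : Quotient s) = ⟦σ d⟧ :=
      Quotient.sound ((le_sup_left : Perm.SameCycle.setoid σ ≤ s) ⟨1, by simp⟩)
    have h1 := s'.trans (hh d) (hσs' (w := σ' (d, h d)) ⟨1, by simp⟩)
    have h2 : σ' (d, h d) = (σ d, (σ' (d, h d)).2) := Prod.ext (hcσ.fst_apply _) rfl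
    rw [h2, hq] at h1
    rw [h2, huniq (s'.trans (s'.symm h1) (hh (σ d)))]
  · have hq : (⟦d⟧ : Quotient s) = ⟦α d⟧ :=
      Quotient.sound ((le_sup_right : Perm.SameCycle.setoid α ≤ s) ⟨1, by simp⟩)
    have h1 := s'.trans (hh d) (hαs' (w := α' (d, h d)) ⟨1, by simp⟩)
    have h2 : α' (d, h d) = (α d, (α' (d, h d)).2) := Prod.ext (hcα.fst_apply _) rfl
    rw [h2, hq] at h1
    rw [h2, huniq (s'.trans (s'.symm h1) (hh (α d)))]

end Covering

/-! ### Euler's formula in terms of darts -/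

namespace RotationSystem

variable {V : Type*} {G : SimpleGraph V} (R : RotationSystem G)

/-- The involution that reverses all darts. -/
def reverse (G : SimpleGraph V) : Perm G.Dart :=
  Function.Involutive.toPerm SimpleGraph.Dart.symm SimpleGraph.Dart.symm_involutive

@[simp] theorem reverse_apply (d : G.Dart) : reverse G d = d.symm := rfl

theorem faceNext_eq_mul : R.faceNext = R.rot * reverse G := rfl

theorem faceNext_apply (d : G.Dart) : R.faceNext d = R.rot d.symm := rfl

@[simp] theorem faceNext_fst (d : G.Dart) : (R.faceNext d).fst = d.snd := R.rot_fst d.symm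

theorem rot_eq_faceNext_symm (d : G.Dart) : R.rot d = R.faceNext d.symm := by
  rw [faceNext_apply, SimpleGraph.Dart.symm_symm]

/-- Two darts are equivalent if they belong to the same component of the graph. -/
def component : Setoid G.Dart :=
  Perm.SameCycle.setoid R.rot ⊔ Perm.SameCycle.setoid (reverse G)

theorem component_of_walk {u v : V} (p : G.Walk u v) (d d' : G.Dart) (hd : d.fst = u)
    (hd' : d'.fst = v) : R.component d d' := by
  induction p generalizing d with
  | nil =>
    exact (le_sup_left : Perm.SameCycle.setoid R.rot ≤ R.component)
      (R.rot_sameCycle d d' (hd.trans hd'.symm))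
  | @cons u w v h p ih =>
    have h1 : R.component d ⟨(u, w), h⟩ :=
      (le_sup_left : Perm.SameCycle.setoid R.rot ≤ R.component) (R.rot_sameCycle _ _ hd)
    have h2 : R.component ⟨(u, w), h⟩ ⟨(w, u), h.symm⟩ :=
      (le_sup_right : Perm.SameCycle.setoid (reverse G) ≤ R.component) ⟨1, rfl⟩
    exact R.component.trans (R.component.trans h1 h2) (ih _ rfl hd')

theorem reachable_of_component {d d' : G.Dart} (h : R.component d d') :
    G.Reachable d.fst d'.fst := by
  have : R.component ≤ G.reachableSetoid.comap fun d : G.Dart => d.fst := by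
    refine sup_le ?_ ?_
    · exact fun d d' h => SimpleGraph.ConnectedComponent.eq.1 (Perm.SameCycle.apply_eq
        (f := fun d : G.Dart => G.connectedComponentMk d.fst) (fun d => by rw [R.rot_fst]) h)
    · exact fun d d' h => SimpleGraph.ConnectedComponent.eq.1 (Perm.SameCycle.apply_eq
        (f := fun d : G.Dart => G.connectedComponentMk d.fst)
        (fun d => SimpleGraph.ConnectedComponent.eq.2 d.adj.symm.reachable) h)
  exact this h

/-- An isolated vertex contributes a vertex, a face and a component, which cancel in Euler's
formula, so passing to darts loses nothing. -/
theorem IsSpherical.le_card_cycles [Finite V] {R : RotationSystem G} (hR : R.IsSpherical) :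
    Nat.card G.Dart + 2 * Nat.card (Quotient R.component) ≤
      Nat.card (Quotient (Perm.SameCycle.setoid R.rot)) +
        Nat.card (Quotient (Perm.SameCycle.setoid R.faceNext)) +
        Nat.card (Quotient (Perm.SameCycle.setoid (reverse G))) := by
  classical
  have := Fintype.ofFinite V
  have hV : Nat.card V ≤ Nat.card (Quotient (Perm.SameCycle.setoid R.rot)) +
      Nat.card {v : V // ∀ w, ¬ G.Adj v w} := by
    rw [← Nat.card_sum]
    refine Nat.card_le_card_of_surjective (Sum.elim
      (Quotient.lift (fun d : G.Dart => d.fst) ?_) Subtype.val) ?_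
    · exact fun d d' h =>
        Perm.SameCycle.apply_eq (f := fun d : G.Dart => d.fst) (σ := R.rot) R.rot_fst h
    · intro v
      by_cases h : ∃ w, G.Adj v w
      · obtain ⟨w, hw⟩ := h
        exact ⟨.inl ⟦⟨(v, w), hw⟩⟧, rfl⟩
      · exact ⟨.inr ⟨v, not_exists.1 h⟩, rfl⟩
  have hE : Nat.card G.edgeSet ≤ Nat.card (Quotient (Perm.SameCycle.setoid (reverse G))) := by
    refine Nat.card_le_card_of_surjective (Quotient.lift
      (fun d : G.Dart => (⟨d.edge, d.edge_mem⟩ : G.edgeSet)) ?_) ?_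
    · exact fun d d' h => Perm.SameCycle.apply_eq (σ := reverse G)
        (f := fun d : G.Dart => (⟨d.edge, d.edge_mem⟩ : G.edgeSet)) (fun d => by simp) h
    · rintro ⟨e, he⟩
      induction e using Sym2.ind with
      | _ v w => exact ⟨⟦⟨(v, w), he⟩⟧, rfl⟩
  have hC : Nat.card (Quotient R.component) + Nat.card {v : V // ∀ w, ¬ G.Adj v w} ≤
      Nat.card G.ConnectedComponent := by
    rw [← Nat.card_sum]
    refine Nat.card_le_card_of_injective (Sum.elim
      (Quotient.lift (fun d : G.Dart => G.connectedComponentMk d.fst) ?_)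
      (fun v => G.connectedComponentMk v)) ?_
    · exact fun d d' h => SimpleGraph.ConnectedComponent.eq.2 (R.reachable_of_component h)
    · have isolated {u v : V} (hu : ∀ w, ¬ G.Adj u w) (h : G.Reachable u v) : u = v := by
        obtain ⟨p⟩ := h
        cases p with
        | nil => rfl
        | cons h p => exact absurd h (hu _)
      rintro (d | v) (d' | v') h
      · induction d, d' using Quotient.inductionOn₂ with
        | _ d d' =>
        obtain ⟨p⟩ := SimpleGraph.ConnectedComponent.eq.1 h
        exact congrArg Sum.inl (Quotient.sound (R.component_of_walk p d d' rfl rfl))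
      · induction d using Quotient.inductionOn with
        | _ d =>
        have := isolated v'.2 (SimpleGraph.ConnectedComponent.eq.1 h).symm
        exact absurd (this ▸ d.adj) (v'.2 _)
      · induction d' using Quotient.inductionOn with
        | _ d =>
        have := isolated v.2 (SimpleGraph.ConnectedComponent.eq.1 h)
        exact absurd (this ▸ d.adj) (v.2 _)
      · exact congrArg Sum.inr (Subtype.ext (isolated v.2 (SimpleGraph.ConnectedComponent.eq.1 h)))
  have hD : Nat.card G.Dart = 2 * Nat.card G.edgeSet := by
    rw [Nat.card_eq_fintype_card, Nat.card_eq_fintype_card, G.dart_card_eq_twice_card_edges,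
      SimpleGraph.edgeFinset_card]
  have hF : R.numFaces = Nat.card (Quotient (Perm.SameCycle.setoid R.faceNext)) +
    Nat.card {v : V // ∀ w, ¬ G.Adj v w} := rfl
  unfold IsSpherical at hR
  omega

end RotationSystem

/-! ### Adding a chord to a face -/

namespace RotationSystem

variable {V : Type*} {G : SimpleGraph V} (R : RotationSystem G)

section Chord

variable {G' : SimpleGraph V} (hle : G ≤ G')

/-- The inclusion of the darts of a subgraph. -/
def dartEmbedding : G.Dart ↪ G'.Dart where
  toFun d := ⟨d.toProd, hle d.adj⟩
  inj' _ _ h := SimpleGraph.Dart.ext _ _ (congrArg (fun e : G'.Dart => e.toProd) h)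

/-- The rotation in which the new darts `x` and `y` are inserted just before the darts `d₀` and
`d₂`. -/
noncomputable def insertRot [DecidableEq G'.Dart] (x y : G'.Dart) (d₀ d₂ : G.Dart) :
    Perm G'.Dart :=
  -- The extended rotation fixes `x` and `y`; each swap splices one of them into a cycle.
  swap x (dartEmbedding hle d₀) * (swap y (dartEmbedding hle d₂) *
    R.rot.viaEmbedding (dartEmbedding hle))

variable {R hle} [DecidableEq G'.Dart] {x y : G'.Dart} {d₀ d₂ : G.Dart}
  (hx : x ∉ Set.range (dartEmbedding hle)) (hy : y ∉ Set.range (dartEmbedding hle)) (hxy : x ≠ y)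
  (h02 : d₀ ≠ d₂)

include hx in
theorem insertRot_new_left (hxy : x ≠ y) : R.insertRot hle x y d₀ d₂ x = dartEmbedding hle d₀ := by
  have h1 : x ≠ dartEmbedding hle d₂ := fun h => hx ⟨_, h.symm⟩
  rw [insertRot, Perm.mul_apply, Perm.mul_apply, Perm.viaEmbedding_apply_of_notMem _ _ _ hx,
    swap_apply_of_ne_of_ne hxy h1, swap_apply_left]

include hx hy h02 in
theorem insertRot_new_right : R.insertRot hle x y d₀ d₂ y = dartEmbedding hle d₂ := by
  rw [insertRot, Perm.mul_apply, Perm.mul_apply, Perm.viaEmbedding_apply_of_notMem _ _ _ hy,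
    swap_apply_left, swap_apply_of_ne_of_ne (fun h => hx ⟨_, h⟩)
    (fun h => h02 ((dartEmbedding hle).injective h).symm)]

include hy h02 in
theorem insertRot_old_left {d : G.Dart} (h : R.rot d = d₀) :
    R.insertRot hle x y d₀ d₂ (dartEmbedding hle d) = x := by
  rw [insertRot, Perm.mul_apply, Perm.mul_apply, Perm.viaEmbedding_apply, h,
    swap_apply_of_ne_of_ne (fun h => hy ⟨_, h⟩)
    (fun h => h02 ((dartEmbedding hle).injective h)), swap_apply_right]

include hy hxy in
theorem insertRot_old_right {d : G.Dart} (h : R.rot d = d₂) :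
    R.insertRot hle x y d₀ d₂ (dartEmbedding hle d) = y := by
  rw [insertRot, Perm.mul_apply, Perm.mul_apply, Perm.viaEmbedding_apply, h,
    swap_apply_right, swap_apply_of_ne_of_ne hxy.symm (fun h => hy ⟨_, h.symm⟩)]

include hx hy in
theorem insertRot_old {d : G.Dart} (h₀ : R.rot d ≠ d₀) (h₂ : R.rot d ≠ d₂) :
    R.insertRot hle x y d₀ d₂ (dartEmbedding hle d) = dartEmbedding hle (R.rot d) := by
  rw [insertRot, Perm.mul_apply, Perm.mul_apply, Perm.viaEmbedding_apply,
    swap_apply_of_ne_of_ne (fun h => hy ⟨_, h⟩) (fun h => h₂ ((dartEmbedding hle).injective h)),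
    swap_apply_of_ne_of_ne (fun h => hx ⟨_, h⟩) (fun h => h₀ ((dartEmbedding hle).injective h))]

/-- The rotation system with a chord added whose ends `x` and `y` are inserted just before the
darts `d₀` and `d₂`. -/
noncomputable def insertChord (hxd : x.fst = d₀.fst) (hyd : y.fst = d₂.fst)
    (hnew : ∀ d : G'.Dart, d = x ∨ d = y ∨ d ∈ Set.range (dartEmbedding hle)) :
    RotationSystem G' where
  rot := R.insertRot hle x y d₀ d₂
  rot_fst d := by
    have hfst (d : G.Dart) : (dartEmbedding hle d).fst = d.fst := rfl
    rcases hnew d with rfl | rfl | ⟨d, rfl⟩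
    · rw [insertRot_new_left hx hxy, hxd, hfst]
    · rw [insertRot_new_right hx hy h02, hyd, hfst]
    · by_cases h0 : R.rot d = d₀
      · rw [insertRot_old_left hy h02 h0, hxd, ← h0, R.rot_fst, hfst]
      by_cases h2 : R.rot d = d₂
      · rw [insertRot_old_right hy hxy h2, hyd, ← h2, R.rot_fst, hfst]
      rw [insertRot_old hx hy h0 h2, hfst, hfst, R.rot_fst]
  rot_sameCycle := by
    set ρ := R.insertRot hle x y d₀ d₂ with hρ
    have step (d : G'.Dart) : ρ.SameCycle d (ρ d) := ⟨1, by simp⟩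
    have hx0 : ρ.SameCycle x (dartEmbedding hle d₀) := insertRot_new_left hx hxy ▸ step x
    have hy2 : ρ.SameCycle y (dartEmbedding hle d₂) := insertRot_new_right hx hy h02 ▸ step y
    have hold (d : G.Dart) :
        ρ.SameCycle (dartEmbedding hle d) (dartEmbedding hle (R.rot d)) := by
      have hd := step (dartEmbedding hle d)
      by_cases h0 : R.rot d = d₀
      · rw [hρ, insertRot_old_left hy h02 h0, ← hρ] at hd
        exact h0 ▸ hd.trans hx0
      by_cases h2 : R.rot d = d₂
      · rw [hρ, insertRot_old_right hy hxy h2, ← hρ] at hd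
        exact h2 ▸ hd.trans hy2
      rwa [hρ, insertRot_old hx hy h0 h2, ← hρ] at hd
    have hcyc (d d' : G.Dart) (h : d.fst = d'.fst) :
        ρ.SameCycle (dartEmbedding hle d) (dartEmbedding hle d') := by
      have := Perm.SameCycle.apply_eq
        (f := fun d => (⟦dartEmbedding hle d⟧ : Quotient (Perm.SameCycle.setoid ρ)))
        (fun d => (Quotient.sound (hold d)).symm) (R.rot_sameCycle d d' h)
      exact Quotient.exact this
    have hrep (d : G'.Dart) : ∃ e : G.Dart, e.fst = d.fst ∧
        ρ.SameCycle d (dartEmbedding hle e) := by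
      rcases hnew d with rfl | rfl | ⟨d, rfl⟩
      · exact ⟨d₀, hxd.symm, hx0⟩
      · exact ⟨d₂, hyd.symm, hy2⟩
      · exact ⟨d, rfl, Perm.SameCycle.refl _ _⟩
    intro d d' h
    obtain ⟨e, he, hde⟩ := hrep d
    obtain ⟨e', he', hde'⟩ := hrep d'
    exact (hde.trans (hcyc e e' (he.trans (h.trans he'.symm)))).trans hde'.symm

/-- Adding a chord that cuts the corner between two consecutive edges off a face gives one more
face. -/
theorem card_face_insertChord [Finite V] {d₁ : G.Dart} (h1 : R.faceNext d₀ = d₁)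
    (h2 : R.faceNext d₁ = d₂) (hsymm : x.symm = y)
    (hxd : x.fst = d₀.fst) (hyd : y.fst = d₂.fst)
    (hnew : ∀ d : G'.Dart, d = x ∨ d = y ∨ d ∈ Set.range (dartEmbedding hle)) :
    Nat.card (insertChord (R := R) hx hy hxy h02 hxd hyd hnew).Face = Nat.card R.Face + 1 := by
  classical
  have := Fintype.ofFinite V
  set R' := insertChord (R := R) hx hy hxy h02 hxd hyd hnew with hR'
  set ι := dartEmbedding hle
  have hinj : Function.Injective ι := ι.injective
  have hsymm' : y.symm = x := by rw [← hsymm, SimpleGraph.Dart.symm_symm]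
  have h01 : d₀ ≠ d₁ := by
    intro h
    have := R.faceNext_fst d₀
    rw [h1, ← h] at this
    exact d₀.adj.ne this
  have h12 : d₁ ≠ d₂ := by
    intro h
    have := R.faceNext_fst d₁
    rw [h2, ← h] at this
    exact d₁.adj.ne this
  have hφx : R'.faceNext x = ι d₂ := by
    rw [faceNext_apply, hsymm]; exact insertRot_new_right hx hy h02
  have hφy : R'.faceNext y = ι d₀ := by
    rw [faceNext_apply, hsymm']; exact insertRot_new_left hx hxy
  have hφ0 {d : G.Dart} (h : R.faceNext d = d₀) : R'.faceNext (ι d) = x :=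
    insertRot_old_left hy h02 h
  have hφ2 {d : G.Dart} (h : R.faceNext d = d₂) : R'.faceNext (ι d) = y :=
    insertRot_old_right hy hxy h
  have hφ {d : G.Dart} (h0 : R.faceNext d ≠ d₀) (h2 : R.faceNext d ≠ d₂) :
      R'.faceNext (ι d) = ι (R.faceNext d) := insertRot_old hx hy h0 h2
  let m (d : G.Dart) : R.Face := Quotient.mk (Perm.SameCycle.setoid R.faceNext) d
  let m' (d : G'.Dart) : R'.Face := Quotient.mk (Perm.SameCycle.setoid R'.faceNext) d
  have hm (d : G.Dart) : m (R.faceNext d) = m d :=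
    (Quotient.sound (s := Perm.SameCycle.setoid R.faceNext) ⟨1, by simp⟩).symm
  have hm' (d : G'.Dart) : m' (R'.faceNext d) = m' d :=
    (Quotient.sound (s := Perm.SameCycle.setoid R'.faceNext) ⟨1, by simp⟩).symm
  have hm2 : m d₂ = m d₀ := by rw [← h2, hm, ← h1, hm]
  -- The chord cuts off the triangle `y`, `d₀`, `d₁`, which corresponds to `none`; the rest of the
  -- old face now contains `x`. `g₀` and `f₀` induce inverse bijections.
  let g₀ (d : G.Dart) : R'.Face := if d = d₀ ∨ d = d₁ then m' x else m' (ι d)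
  have hg₀ (d : G.Dart) : g₀ (R.faceNext d) = g₀ d := by
    by_cases hd0 : d = d₀
    · subst hd0; simp [g₀, h1]
    by_cases hd1 : d = d₁
    · subst hd1; simp [g₀, h2, ← hm' x, hφx]
    have e1 : R.faceNext d ≠ d₁ := fun h => hd0 (R.faceNext.injective (h.trans h1.symm))
    have e2 : R.faceNext d ≠ d₂ := fun h => hd1 (R.faceNext.injective (h.trans h2.symm))
    by_cases e0 : R.faceNext d = d₀
    · simp [g₀, e0, hd0, hd1, ← hm' (ι d), hφ0 e0]
    · simp [g₀, e0, hd0, hd1, e1, ← hm' (ι d), hφ e0 e2]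
  let f₁ (d : G.Dart) : Option R.Face := if d = d₀ ∨ d = d₁ then none else some (m d)
  let f₀ : G'.Dart → Option R.Face :=
    Function.extend ι f₁ fun d => if d = y then none else some (m d₀)
  have hfx : f₀ x = some (m d₀) := by
    simp only [f₀]; rw [Function.extend_apply' _ _ _ hx, if_neg hxy]
  have hfy : f₀ y = none := by
    simp only [f₀]; rw [Function.extend_apply' _ _ _ hy, if_pos rfl]
  have hfι (d : G.Dart) : f₀ (ι d) = f₁ d := hinj.extend_apply _ _ _
  have hf₀ (d : G'.Dart) : f₀ (R'.faceNext d) = f₀ d := by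
    rcases hnew d with rfl | rfl | ⟨d, rfl⟩
    · rw [hφx, hfx, hfι]; simp [f₁, h02.symm, h12.symm, hm2]
    · rw [hφy, hfy, hfι]; simp [f₁]
    · by_cases hd0 : d = d₀
      · subst hd0
        rw [hφ (by rw [h1]; exact h01.symm) (by rw [h1]; exact h12), hfι, hfι]; simp [f₁, h1]
      by_cases hd1 : d = d₁
      · subst hd1; rw [hφ2 h2, hfy, hfι]; simp [f₁]
      have e1 : R.faceNext d ≠ d₁ := fun h => hd0 (R.faceNext.injective (h.trans h1.symm))
      have e2 : R.faceNext d ≠ d₂ := fun h => hd1 (R.faceNext.injective (h.trans h2.symm))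
      by_cases e0 : R.faceNext d = d₀
      · rw [hφ0 e0, hfx, hfι]; simp [f₁, hd0, hd1, ← hm d, e0]
      · rw [hφ e0 e2, hfι, hfι]; simp [f₁, hd0, hd1, e0, e1, hm]
  have hcard : Nat.card (Option R.Face) = Nat.card R'.Face := by
    refine Nat.card_congr
      { toFun := fun q => q.elim (m' y)
          (Quotient.lift g₀ fun d d' h => Perm.SameCycle.apply_eq hg₀ h)
        invFun := Quotient.lift f₀ fun d d' h => Perm.SameCycle.apply_eq hf₀ h
        left_inv := ?_
        right_inv := ?_ }
    · rintro (_ | q)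
      · exact hfy
      · induction q using Quotient.inductionOn with
        | _ d =>
        by_cases hd : d = d₀ ∨ d = d₁
        · have : g₀ d = m' x := if_pos hd
          change Quotient.lift f₀ _ (g₀ d) = some (m d)
          rw [this]
          refine hfx.trans ?_
          rcases hd with rfl | rfl
          · rfl
          · rw [← h1, hm]
        · have : g₀ d = m' (ι d) := if_neg hd
          change Quotient.lift f₀ _ (g₀ d) = some (m d)
          rw [this]
          exact (hfι d).trans (if_neg hd)
    · intro q
      induction q using Quotient.inductionOn with
      | _ d =>
      change (f₀ d).elim (m' y) _ = m' d
      rcases hnew d with rfl | rfl | ⟨d, rfl⟩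
      · rw [hfx]; exact if_pos (Or.inl rfl)
      · rw [hfy]; rfl
      · rw [hfι]
        by_cases hd : d = d₀ ∨ d = d₁
        · have : f₁ d = none := if_pos hd
          rw [this]
          change m' y = m' (ι d)
          rw [← hm' y, hφy]
          rcases hd with rfl | rfl
          · rfl
          · rw [← hm' (ι d₀), hφ (by rw [h1]; exact h01.symm) (by rw [h1]; exact h12), h1]
        · have : f₁ d = some (m d) := if_neg hd
          rw [this]
          exact if_neg hd
  have : Finite R.Face := inferInstanceAs (Finite (Quotient _))
  rw [← hcard, Finite.card_option]

end Chord

/-- The chord adds one edge and one face; its ends are already connected through `d.snd`, so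
components and isolated vertices stay the same. -/
theorem IsSpherical.isPlanar_sup_edge [Finite V] {R : RotationSystem G} (hR : R.IsSpherical)
    (d : G.Dart) (hne : d.fst ≠ R.apex d) (hadj : ¬ G.Adj d.fst (R.apex d)) :
    IsPlanar (G ⊔ SimpleGraph.edge d.fst (R.apex d)) := by
  classical
  have := Fintype.ofFinite V
  set a := d.fst with ha
  set c := R.apex d with hc
  set G' := G ⊔ SimpleGraph.edge a c with hG'
  have hle : G ≤ G' := le_sup_left
  have hac : G'.Adj a c := by simp [hG', SimpleGraph.edge_adj, hne]
  let x : G'.Dart := ⟨(a, c), hac⟩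
  let y : G'.Dart := ⟨(c, a), hac.symm⟩
  have hx : x ∉ Set.range (dartEmbedding hle) := by
    rintro ⟨e, he⟩
    have h := e.adj
    have h1 : e.toProd = (a, c) := congrArg SimpleGraph.Dart.toProd he
    rw [h1] at h
    exact hadj h
  have hy : y ∉ Set.range (dartEmbedding hle) := by
    rintro ⟨e, he⟩
    have h := e.adj
    have h1 : e.toProd = (c, a) := congrArg SimpleGraph.Dart.toProd he
    rw [h1] at h
    exact hadj h.symm
  have hxy : x ≠ y := fun h => hne (congrArg (fun e : G'.Dart => e.fst) h)
  have hc2 : (R.faceNext (R.faceNext d)).fst = c := by rw [faceNext_fst]; rfl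
  have h02 : d ≠ R.faceNext (R.faceNext d) := by
    intro h
    rw [← h] at hc2
    exact hne hc2
  have hadj' {u v : V} (h : G'.Adj u v) : G.Adj u v ∨ (u = a ∧ v = c) ∨ (u = c ∧ v = a) := by
    rw [hG', SimpleGraph.sup_adj, SimpleGraph.edge_adj] at h
    tauto
  have hnew (e : G'.Dart) : e = x ∨ e = y ∨ e ∈ Set.range (dartEmbedding hle) := by
    rcases hadj' e.adj with h | ⟨h1, h2⟩ | ⟨h1, h2⟩
    · exact Or.inr (Or.inr ⟨⟨e.toProd, h⟩, rfl⟩)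
    · exact Or.inl (SimpleGraph.Dart.ext _ _ (Prod.ext h1 h2))
    · exact Or.inr (Or.inl (SimpleGraph.Dart.ext _ _ (Prod.ext h1 h2)))
  refine ⟨insertChord (R := R) hx hy hxy h02 rfl hc2.symm hnew, ?_⟩
  have hF := card_face_insertChord (R := R) hx hy hxy h02 rfl rfl rfl rfl hc2.symm hnew
  have hE : Nat.card G'.edgeSet = Nat.card G.edgeSet + 1 := by
    have : G'.edgeSet = insert s(a, c) G.edgeSet := by
      rw [hG', SimpleGraph.edgeSet_sup, SimpleGraph.edgeSet_edge_of_ne hne, Set.union_singleton]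
    rw [this, Nat.card_coe_set_eq, Nat.card_coe_set_eq, Set.ncard_insert_of_notMem]
    exact hadj
  have hreach : G.Reachable a c := by
    have h2 := (R.faceNext d).adj.reachable
    rw [faceNext_fst] at h2
    exact d.adj.reachable.trans h2
  have hC : Nat.card G'.ConnectedComponent = Nat.card G.ConnectedComponent := by
    symm
    refine Nat.card_eq_of_bijective
      (SimpleGraph.ConnectedComponent.map (SimpleGraph.Hom.ofLE hle)) ⟨?_, ?_⟩
    · intro p q
      induction p, q using SimpleGraph.ConnectedComponent.ind₂ with
      | _ u v =>
      intro h
      simp only [SimpleGraph.ConnectedComponent.map_mk, SimpleGraph.ConnectedComponent.eq] at h ⊢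
      obtain ⟨p⟩ := h
      change G'.Walk u v at p
      induction p with
      | nil => rfl
      | cons h p ih =>
        refine SimpleGraph.Reachable.trans ?_ ih
        rcases hadj' h with h | ⟨rfl, rfl⟩ | ⟨rfl, rfl⟩
        · exact h.reachable
        · exact hreach
        · exact hreach.symm
    · intro p
      induction p using SimpleGraph.ConnectedComponent.ind with
      | _ u => exact ⟨G.connectedComponentMk u, rfl⟩
  have hI : Nat.card {v : V // ∀ w, ¬ G'.Adj v w} = Nat.card {v : V // ∀ w, ¬ G.Adj v w} := by
    refine Nat.card_congr (Equiv.subtypeEquivRight fun v => ?_)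
    refine ⟨fun h w hw => h w (hle hw), fun h w hw => ?_⟩
    rcases hadj' hw with hw | ⟨rfl, -⟩ | ⟨rfl, -⟩
    · exact h w hw
    · exact h _ d.adj
    · have h2 := (R.faceNext d).adj
      exact h _ h2.symm
  unfold IsSpherical numFaces at hR ⊢
  rw [hF, hE, hC, hI]
  omega

end RotationSystem

/-! ### Monodromy around vertices; triangles separate the sphere -/

theorem Equiv.Perm.IsCycleOn.sum_range_pow {α M : Type*} [AddCommMonoid M] {f : Perm α}
    {s : Finset α} (hf : f.IsCycleOn s) {a : α} (ha : a ∈ s) (g : α → M) :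
    ∑ i ∈ Finset.range s.card, g ((f ^ i) a) = ∑ x ∈ s, g x := by
  refine Finset.sum_bij (fun i _ => (f ^ i) a) (fun i _ => hf.1.mapsTo.perm_pow i ha) ?_ ?_
    (fun _ _ => rfl)
  · intro i hi j hj hij
    rw [hf.pow_apply_eq_pow_apply ha] at hij
    exact hij.eq_of_lt_of_lt (Finset.mem_range.1 hi) (Finset.mem_range.1 hj)
  · intro b hb
    obtain ⟨n, hn, h⟩ := hf.exists_pow_eq ha hb
    exact ⟨n, Finset.mem_range.2 hn, h⟩

theorem Equiv.Perm.IsCovering.of_involutive {D X : Type*} {α : Perm D} {α' : Perm (D × X)}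
    (hα : ∀ d, α (α d) = d) (hne : ∀ d, α d ≠ d) (hfst : ∀ z, (α' z).1 = α z.1)
    (hα' : ∀ z, α' (α' z) = z) : α.IsCovering α' := by
  refine ⟨hfst, fun k z hk => ?_⟩
  have h2 : α ^ 2 = 1 := by ext1 d; simp [pow_two, hα]
  have h2' : α' ^ 2 = 1 := by ext1 d; simp [pow_two, hα']
  obtain ⟨m, rfl | rfl⟩ := k.even_or_odd'
  · rw [pow_mul, h2', one_pow, Perm.one_apply]
  · rw [pow_add, pow_mul, h2] at hk
    exact absurd (by simpa using hk) (hne z.1)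

theorem Equiv.Perm.prodShear_addRight_pow_apply {D A : Type*} [AddCommGroup A] (σ : Perm D)
    (s : D → A) (k : ℕ) (d : D) (x : A) :
    ((prodShear σ fun d => Equiv.addRight (s d) : Perm (D × A)) ^ k) (d, x) =
      ((σ ^ k) d, x + ∑ i ∈ Finset.range k, s ((σ ^ i) d)) := by
  induction k with
  | zero => simp
  | succ k ih =>
    rw [pow_succ', Perm.mul_apply, ih, Finset.sum_range_succ, pow_succ', Perm.mul_apply, ← add_assoc]
    rfl

namespace RotationSystem

variable {V : Type*} {G : SimpleGraph V} (R : RotationSystem G)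

theorem apply_eq_of_fst_eq {Y : Type*} {f : G.Dart → Y} {v : V}
    (h : ∀ d : G.Dart, d.fst = v → f (R.rot d) = f d) {d d' : G.Dart} (hd : d.fst = v)
    (hd' : d'.fst = v) : f d = f d' := by
  classical
  -- The value `none` away from `v` makes the function invariant everywhere.
  have := Perm.SameCycle.apply_eq (σ := R.rot)
    (f := fun d => if d.fst = v then some (f d) else none) (fun d => by
      simp only [R.rot_fst]
      split_ifs with hdv
      · rw [h d hdv]
      · rfl) (R.rot_sameCycle d d' (hd.trans hd'.symm))
  simpa [hd, hd'] using this

theorem rot_isCycleOn [Fintype V] [DecidableEq V] [DecidableRel G.Adj] (v : V) :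
    R.rot.IsCycleOn (({d : G.Dart | d.fst = v} : Finset G.Dart) : Set G.Dart) := by
  have hcoe : (({d : G.Dart | d.fst = v} : Finset G.Dart) : Set G.Dart) = {d | d.fst = v} := by
    ext; simp
  rw [hcoe]
  refine ⟨⟨fun d hd => (R.rot_fst d).trans hd, R.rot.injective.injOn, fun d hd => ?_⟩,
    fun d hd d' hd' => R.rot_sameCycle d d' (hd.trans hd'.symm)⟩
  refine ⟨R.rot⁻¹ d, ?_, by simp⟩
  have := R.rot_fst (R.rot⁻¹ d)
  rw [Perm.coe_inv, Equiv.apply_symm_apply] at this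
  exact this.symm.trans hd

theorem rot_pow_apply_eq [Fintype V] [DecidableRel G.Adj] (d : G.Dart) (n : ℕ) :
    (R.rot ^ n) d = d ↔ G.degree d.fst ∣ n := by
  classical
  rw [(R.rot_isCycleOn d.fst).pow_apply_eq (by simp), G.dart_fst_fiber_card_eq_degree]

theorem isCovering_rot [Fintype V] [DecidableRel G.Adj] {X : Type*} {σ' : Perm (G.Dart × X)}
    (hfst : ∀ z, (σ' z).1 = R.rot z.1)
    (hdeg : ∀ d x, (σ' ^ G.degree d.fst) (d, x) = (d, x)) : R.rot.IsCovering σ' := by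
  refine ⟨hfst, fun k z hk => ?_⟩
  obtain ⟨m, rfl⟩ := (R.rot_pow_apply_eq z.1 k).1 hk
  rw [pow_mul]
  exact Perm.pow_apply_eq_self_of_apply_eq_self (hdeg z.1 z.2) m

/-- The indicator function of the darts that join two of three given vertices. -/
def triangleIndicator [DecidableEq V] (a b c : V) (d : G.Dart) : ZMod 2 :=
  if d.fst ∈ ({a, b, c} : Finset V) ∧ d.snd ∈ ({a, b, c} : Finset V) then 1 else 0

theorem triangleIndicator_eq_one [DecidableEq V] {a b c : V} {d : G.Dart}
    (h : d.fst = a ∨ d.fst = b ∨ d.fst = c) (h' : d.snd = a ∨ d.snd = b ∨ d.snd = c) :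
    triangleIndicator a b c d = 1 := by
  simp [triangleIndicator, h, h']

theorem triangleIndicator_eq_zero [DecidableEq V] {a b c : V} {d : G.Dart}
    (h : ¬ (d.fst = a ∨ d.fst = b ∨ d.fst = c) ∨ ¬ (d.snd = a ∨ d.snd = b ∨ d.snd = c)) :
    triangleIndicator a b c d = 0 := by
  simp only [triangleIndicator, Finset.mem_insert, Finset.mem_singleton]
  rw [if_neg]
  tauto

theorem triangleIndicator_symm [DecidableEq V] (a b c : V) (d : G.Dart) :
    triangleIndicator a b c d.symm = triangleIndicator a b c d := by
  simp only [triangleIndicator, SimpleGraph.Dart.symm_toProd, Prod.fst_swap, Prod.snd_swap,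
    and_comm]

/-- Each vertex has two or no darts in the triangle, so the monodromy around it vanishes mod 2. -/
theorem sum_triangleIndicator [Fintype V] [DecidableEq V] [DecidableRel G.Adj] {a b c : V}
    (hab : G.Adj a b) (hbc : G.Adj b c) (hac : G.Adj a c) (v : V) :
    ∑ d : G.Dart with d.fst = v, triangleIndicator a b c d = 0 := by
  have key {v p q : V} (hp : G.Adj v p) (hq : G.Adj v q) (hpq : p ≠ q)
      (hT : ({a, b, c} : Finset V) = {v, p, q}) :
      ∑ d : G.Dart with d.fst = v, triangleIndicator a b c d = 0 := by
    have hfilter : ({d : G.Dart | d.fst = v ∧ d.fst ∈ ({a, b, c} : Finset V) ∧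
        d.snd ∈ ({a, b, c} : Finset V)} : Finset G.Dart) = {⟨(v, p), hp⟩, ⟨(v, q), hq⟩} := by
      ext d
      simp only [hT, Finset.mem_filter, Finset.mem_univ, true_and, Finset.mem_insert,
        Finset.mem_singleton, SimpleGraph.Dart.ext_iff, Prod.ext_iff]
      have hne := d.adj.ne
      constructor
      · rintro ⟨h, -, h' | h' | h'⟩
        · exact absurd (h.trans h'.symm) hne
        · exact Or.inl ⟨h, h'⟩
        · exact Or.inr ⟨h, h'⟩
      · rintro (⟨h, h'⟩ | ⟨h, h'⟩)
        · exact ⟨h, Or.inl h, Or.inr (Or.inl h')⟩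
        · exact ⟨h, Or.inl h, Or.inr (Or.inr h')⟩
    simp only [triangleIndicator]
    rw [Finset.sum_ite, Finset.filter_filter, hfilter, Finset.sum_const_zero, add_zero,
      Finset.sum_pair]
    · rfl
    · simpa using hpq
  by_cases ha : v = a
  · subst ha; exact key hab hac hbc.ne rfl
  by_cases hb : v = b
  · subst hb; exact key hab.symm hbc hac.ne (by ext; simp; tauto)
  by_cases hc : v = c
  · subst hc; exact key hac.symm hbc.symm hab.ne (by ext; simp; tauto)
  refine Finset.sum_eq_zero fun d hd => triangleIndicator_eq_zero (Or.inl ?_)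
  rw [(Finset.mem_filter.1 hd).2]
  tauto

/-- A triangle separates a spherical map: its faces have two sides such that one changes the side
exactly when crossing an edge of the triangle. -/
theorem IsSpherical.exists_sides [Finite V] [DecidableEq V] {R : RotationSystem G}
    (hR : R.IsSpherical) {a b c : V}
    (hab : G.Adj a b) (hbc : G.Adj b c) (hac : G.Adj a c) :
    ∃ h : G.Dart → ZMod 2, (∀ d, h (R.rot d) = h d + triangleIndicator a b c d) ∧
      ∀ d, h d.symm = h d + triangleIndicator a b c d := by
  classical
  have := Fintype.ofFinite V
  let s : G.Dart → ZMod 2 := triangleIndicator a b c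
  let σ' : Perm (G.Dart × ZMod 2) := prodShear R.rot fun d => Equiv.addRight (s d)
  let α' : Perm (G.Dart × ZMod 2) := prodShear (reverse G) fun d => Equiv.addRight (s d)
  have two (x y : ZMod 2) : x + y + y = x := by
    rw [add_assoc, CharTwo.add_self_eq_zero, add_zero]
  have hα' (z : G.Dart × ZMod 2) : α' (α' z) = z := by
    refine Prod.ext (SimpleGraph.Dart.symm_symm z.1) ?_
    change z.2 + s z.1 + s z.1.symm = z.2
    rw [show s z.1.symm = s z.1 from triangleIndicator_symm a b c z.1, two]
  -- The shifts of `α'` and `σ'` cancel: following a face never changes the side.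
  have hφ' (z : G.Dart × ZMod 2) : (σ' * α') z = (R.faceNext z.1, z.2) := by
    refine Prod.ext rfl ?_
    change z.2 + s z.1 + s z.1.symm = z.2
    rw [show s z.1.symm = s z.1 from triangleIndicator_symm a b c z.1, two]
  have hcσ : R.rot.IsCovering σ' := by
    refine R.isCovering_rot (fun z => rfl) fun d x => ?_
    rw [Perm.prodShear_addRight_pow_apply, ← G.dart_fst_fiber_card_eq_degree,
      (R.rot_isCycleOn d.fst).sum_range_pow (by simp), sum_triangleIndicator hab hbc hac, add_zero,
      (R.rot_isCycleOn d.fst).pow_card_apply (by simp)]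
  have hcα : (reverse G).IsCovering α' :=
    .of_involutive SimpleGraph.Dart.symm_symm SimpleGraph.Dart.symm_ne (fun z => rfl) hα'
  have hcφ : (R.rot * reverse G).IsCovering (σ' * α') := by
    refine ⟨fun z => rfl, fun k z hk => ?_⟩
    have hpow : ((σ' * α') ^ k) z = ((R.faceNext ^ k) z.1, z.2) := by
      clear hk
      induction k with
      | zero => rfl
      | succ k ih => rw [pow_succ', Perm.mul_apply, ih, hφ', pow_succ', Perm.mul_apply]
    rw [hpow]
    exact Prod.ext hk rfl
  obtain ⟨h, h1, h2⟩ := Perm.IsCovering.exists_section hα' hcσ hcα hcφ hR.le_card_cycles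
  exact ⟨h, fun d => (congrArg Prod.snd (h1 d)).symm, fun d => (congrArg Prod.snd (h2 d)).symm⟩

/-- The diagonals `a c` and `b e` of a face with consecutive vertices `a`, `b`, `c`, `e` cannot both
be drawn outside of the face. -/
theorem IsSpherical.not_adj_of_adj_of_face [Finite V] {R : RotationSystem G} (hR : R.IsSpherical)
    (d : G.Dart) (hac : G.Adj d.fst (R.faceNext d).snd)
    (hea : (R.faceNext (R.faceNext d)).snd ≠ d.fst) :
    ¬ G.Adj d.snd (R.faceNext (R.faceNext d)).snd := by
  classical
  intro hbe
  set d₁ := R.faceNext d with hd₁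
  set d₂ := R.faceNext d₁ with hd₂
  have h1 : d₁.fst = d.snd := R.faceNext_fst d
  have h2 : d₂.fst = d₁.snd := R.faceNext_fst d₁
  have hab := d.adj
  have hbc : G.Adj d.snd d₁.snd := h1 ▸ d₁.adj
  have hce : G.Adj d₁.snd d₂.snd := h2 ▸ d₂.adj
  obtain ⟨h, hrot, hsymm⟩ := hR.exists_sides hab hbc hac
  have hface (x : G.Dart) : h (R.faceNext x) = h x := by
    rw [faceNext_apply, hrot, hsymm, triangleIndicator_symm, add_assoc, CharTwo.add_self_eq_zero,
      add_zero]
  have hd1 : R.rot d.symm = d₁ := rfl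
  have hne : d.symm ≠ d₁ := fun heq => hac.ne (congrArg (fun e : G.Dart => e.snd) heq)
  -- all the darts at `b` except `b → c` are on the other side
  have hb {x : G.Dart} (hx : x.fst = d.snd) (hxd : x ≠ d₁) : h x = h d₁ + 1 := by
    -- At b the side changes only on the steps into and out of `d₁`; adding 1 at `d₁` cancels both
    -- jumps.
    have key := R.apply_eq_of_fst_eq (v := d.snd)
      (f := fun x => if x = d₁ then h x + 1 else h x) (fun x hx => by
        by_cases hxs : x = d.symm
        · subst hxs
          rw [hd1, if_pos rfl, if_neg hne, ← hd1, hrot, triangleIndicator_eq_one (by simp) (by simp),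
            add_assoc, CharTwo.add_self_eq_zero, add_zero]
        have hrx : R.rot x ≠ d₁ := fun heq => hxs (R.rot.injective (heq.trans hd1.symm))
        by_cases hx1 : x = d₁
        · subst hx1
          rw [if_pos rfl, if_neg hrx, hrot, triangleIndicator_eq_one (by simp [h1]) (by simp)]
        rw [if_neg hrx, if_neg hx1, hrot, triangleIndicator_eq_zero, add_zero]
        right
        rintro (hxa | hxb | hxc)
        · exact hxs (SimpleGraph.Dart.ext _ _ (Prod.ext hx hxa))
        · exact x.adj.ne (hx.trans hxb.symm)
        · exact hx1 (SimpleGraph.Dart.ext _ _ (Prod.ext (hx.trans h1.symm) hxc)))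
      hx h1
    simpa [hxd] using key
  have he {x y : G.Dart} (hx : x.fst = d₂.snd) (hy : y.fst = d₂.snd) : h x = h y := by
    refine R.apply_eq_of_fst_eq (v := d₂.snd) (fun x hx => ?_) hx hy
    rw [hrot, triangleIndicator_eq_zero, add_zero]
    left
    rw [hx]
    rintro (h | h | h)
    · exact hea h
    · exact hbe.ne h.symm
    · exact hce.ne h.symm
  -- The edge be leaves b on the side away from the face but reaches e on the side of the face,
  -- without being an edge of the triangle.
  let y : G.Dart := ⟨(d.snd, d₂.snd), hbe⟩
  have hy1 : h y = h d₁ + 1 := hb rfl fun heq => hce.ne (congrArg (fun e : G.Dart => e.snd) heq).symm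
  have hy2 : h y.symm = h d₁ := by
    rw [he (x := y.symm) (y := R.faceNext d₂) rfl (R.faceNext_fst d₂), hface, hface]
  rw [hsymm, hy1, triangleIndicator_eq_zero, add_zero] at hy2
  · exact one_ne_zero (add_eq_left.1 hy2)
  · right
    rintro (h | h | h)
    · exact hea h
    · exact hbe.ne h.symm
    · exact hce.ne h.symm

end RotationSystem

/-! ### Faces of a maximal planar graph -/

namespace RotationSystem

variable {V : Type*} {G : SimpleGraph V} {R : RotationSystem G}

/-- Faces have length exactly 3, so only exponents divisible by 3 matter when checking the covering
condition on faces. -/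
theorem faceNext_faceNext_ne (htri : ∀ d : G.Dart, R.faceNext (R.faceNext (R.faceNext d)) = d)
    (d : G.Dart) : R.faceNext d ≠ d ∧ R.faceNext (R.faceNext d) ≠ d := by
  have h1 (d : G.Dart) : R.faceNext d ≠ d := by
    intro h
    have := R.faceNext_fst d
    rw [h] at this
    exact d.adj.ne this
  refine ⟨h1 d, fun h => h1 d ?_⟩
  have := htri d
  rwa [h] at this

/-- The faces of a maximal planar graph without vertices of degree one are triangles. -/
theorem IsSpherical.triangular_of_isMaximalPlanar [Finite V] (hG : IsMaximalPlanar G)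
    (hR : R.IsSpherical) (hrot : ∀ d, R.rot d ≠ d) (d : G.Dart) :
    R.faceNext (R.faceNext (R.faceNext d)) = d := by
  have hne (d : G.Dart) : d.fst ≠ R.apex d := by
    intro h
    refine hrot d.symm (SimpleGraph.Dart.ext _ _ (Prod.ext (R.rot_fst _) h.symm))
  have hadj (d : G.Dart) : G.Adj d.fst (R.apex d) := by
    by_contra h
    have hle := hG.2 (hR.isPlanar_sup_edge d (hne d) h) le_sup_left
    exact h (hle (by simp [SimpleGraph.edge_adj, hne d]))
  have hbe (d : G.Dart) : G.Adj d.snd (R.faceNext (R.faceNext d)).snd := by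
    have := hadj (R.faceNext d)
    rwa [faceNext_fst] at this
  -- the boundary of the face closes after three steps, at least for the vertices
  have hclose (d : G.Dart) : (R.faceNext (R.faceNext d)).snd = d.fst := by
    by_contra h
    exact hR.not_adj_of_adj_of_face d (hadj d) h (hbe d)
  refine SimpleGraph.Dart.ext _ _ (Prod.ext ?_ ?_)
  · rw [faceNext_fst, hclose]
  · rw [hclose (R.faceNext d), faceNext_fst]

/-! ### Colorings and degrees -/

variable [Fintype V] [DecidableRel G.Adj]

theorem R4Colorable.three_dvd_degree (h : R.R4Colorable) (v : V) : 3 ∣ G.degree v := by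
  obtain ⟨c, htri, hdist⟩ := h
  by_cases hv : ∃ w, G.Adj v w
  swap
  · have : G.degree v = 0 := by
      by_contra h
      exact hv ((G.degree_pos_iff_exists_adj v).1 (Nat.pos_of_ne_zero h))
    simp [this]
  obtain ⟨w, hw⟩ := hv
  let q (d : G.Dart) : Fin 4 := c d.snd
  have hapex (d : G.Dart) : R.apex (R.rot d) = d.snd := by
    have : R.faceNext (R.faceNext (R.rot d)) = d.symm := by
      rw [rot_eq_faceNext_symm, htri]
    rw [apex, ← R.faceNext_fst, this]
    rfl
  have hstep (d : G.Dart) :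
      Function.Injective ![c d.fst, q (R.rot d), q d, q (R.rot (R.rot d))] := by
    have := hdist (R.rot d)
    rw [hapex, R.rot_fst, apex, ← rot_eq_faceNext_symm] at this
    exact this
  -- `a` is the color of the center, the others those of successive neighbors.
  have hfour : ∀ a x₀ x₁ x₂ x₃ : Fin 4, Function.Injective ![a, x₁, x₀, x₂] →
      Function.Injective ![a, x₂, x₁, x₃] → x₃ = x₀ ∧ x₁ ≠ x₀ ∧ x₂ ≠ x₀ := by
    decide
  have hq (d : G.Dart) : q (R.rot (R.rot (R.rot d))) = q d ∧ q (R.rot d) ≠ q d ∧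
      q (R.rot (R.rot d)) ≠ q d := by
    refine hfour (c d.fst) _ _ _ _ (hstep d) ?_
    have := hstep (R.rot d)
    rwa [R.rot_fst] at this
  have hperiod (m : ℕ) (d : G.Dart) : q ((R.rot ^ (3 * m)) d) = q d := by
    induction m with
    | zero => rfl
    | succ m ih =>
      rw [mul_add, mul_one, add_comm, pow_add, Perm.mul_apply]
      exact (hq _).1.trans ih
  let d : G.Dart := ⟨(v, w), hw⟩
  have hd : (R.rot ^ G.degree v) d = d := (R.rot_pow_apply_eq d _).2 dvd_rfl
  have hdm := Nat.div_add_mod (G.degree v) 3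
  rw [Nat.dvd_iff_mod_eq_zero]
  have hlt := Nat.mod_lt (G.degree v) (show 3 > 0 by norm_num)
  rw [← hdm, pow_add, Perm.mul_apply] at hd
  have hqd := hperiod (G.degree v / 3) ((R.rot ^ (G.degree v % 3)) d)
  rw [hd] at hqd
  interval_cases hr : G.degree v % 3
  · rfl
  · exact absurd hqd.symm (hq d).2.1
  · exact absurd hqd.symm (hq d).2.2

theorem IsSpherical.r4Colorable (hR : R.IsSpherical)
    (htri : ∀ d : G.Dart, R.faceNext (R.faceNext (R.faceNext d)) = d)
    (hdeg : ∀ v, 3 ∣ G.degree v) : R.R4Colorable := by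
  classical
  -- Positions 0, 1, 2, 3 stand for u, v, w, w'. Reversal exchanges u with v and w with w'; a face
  -- step cycles u, v, w and keeps the fourth color.
  let τ : Perm (Fin 4) := swap 0 1 * swap 2 3
  let κ : Perm (Fin 4) := swap 0 1 * swap 1 2
  have hτ : τ * τ = 1 := by decide
  have hκ : κ ^ 3 = 1 := by decide
  have hτκ : (τ * κ) ^ 3 = 1 := by decide
  have hpow (p : Perm G.Dart) (g : Perm (Fin 4)) (k : ℕ) (z : G.Dart × Perm (Fin 4)) :
      ((prodCongr p (Equiv.mulRight g) : Perm (G.Dart × Perm (Fin 4))) ^ k) z =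
        ((p ^ k) z.1, z.2 * g ^ k) := by
    induction k with
    | zero => rfl
    | succ k ih =>
      rw [pow_succ', Perm.mul_apply, ih, pow_succ', Perm.mul_apply, pow_succ, ← mul_assoc]
      rfl
  let σ' : Perm (G.Dart × Perm (Fin 4)) := prodCongr R.rot (Equiv.mulRight (τ * κ))
  let α' : Perm (G.Dart × Perm (Fin 4)) := prodCongr (reverse G) (Equiv.mulRight τ)
  have hα' (z : G.Dart × Perm (Fin 4)) : α' (α' z) = z := by
    refine Prod.ext (SimpleGraph.Dart.symm_symm z.1) ?_
    change z.2 * τ * τ = z.2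
    rw [mul_assoc, hτ, mul_one]
  have hφ' : σ' * α' = prodCongr R.faceNext (Equiv.mulRight κ) := by
    ext1 z
    refine Prod.ext rfl ?_
    change z.2 * τ * (τ * κ) = z.2 * κ
    rw [mul_assoc, ← mul_assoc τ, hτ, one_mul]
  have hcσ : R.rot.IsCovering σ' := by
    refine R.isCovering_rot (fun z => rfl) fun d x => ?_
    obtain ⟨m, hm⟩ := hdeg d.fst
    rw [hpow, (R.rot_pow_apply_eq d _).2 dvd_rfl, hm, pow_mul, hτκ, one_pow, mul_one]
  have hcα : (reverse G).IsCovering α' :=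
    .of_involutive SimpleGraph.Dart.symm_symm SimpleGraph.Dart.symm_ne (fun z => rfl) hα'
  have hcφ : (R.rot * reverse G).IsCovering (σ' * α') := by
    refine ⟨fun z => rfl, fun k z hk => ?_⟩
    have h3 : R.faceNext ^ 3 = 1 := by ext1 d; exact htri d
    rw [← faceNext_eq_mul, ← Nat.div_add_mod k 3, pow_add, pow_mul, h3, one_pow, one_mul] at hk
    have hk0 : k % 3 = 0 := by
      have hlt := Nat.mod_lt k (show 3 > 0 by norm_num)
      interval_cases hr : k % 3
      · rfl
      · exact absurd hk (faceNext_faceNext_ne htri z.1).1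
      · exact absurd hk (faceNext_faceNext_ne htri z.1).2
    obtain ⟨m, rfl⟩ := Nat.dvd_of_mod_eq_zero hk0
    rw [hφ', hpow, pow_mul, pow_mul, h3, hκ, one_pow, one_pow, mul_one]
    rfl
  obtain ⟨h, hσ, hα⟩ := Perm.IsCovering.exists_section hα' hcσ hcα hcφ hR.le_card_cycles
  replace hσ (d : G.Dart) : h (R.rot d) = h d * (τ * κ) := (congrArg Prod.snd (hσ d)).symm
  replace hα (d : G.Dart) : h d.symm = h d * τ := (congrArg Prod.snd (hα d)).symm
  -- Well defined since τκ fixes 0; isolated vertices get an arbitrary color.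
  let c (v : V) : Fin 4 := if hv : ∃ d : G.Dart, d.fst = v then h hv.choose 0 else 0
  have hc (d : G.Dart) : c d.fst = h d 0 := by
    have hv : ∃ d' : G.Dart, d'.fst = d.fst := ⟨d, rfl⟩
    rw [show c d.fst = h hv.choose 0 from dif_pos hv]
    refine R.apply_eq_of_fst_eq (f := fun d => h d 0) (fun d _ => ?_) hv.choose_spec rfl
    simp only [hσ]
    rfl
  have hc1 (d : G.Dart) : c d.snd = h d 1 := by
    rw [show d.snd = d.symm.fst from rfl, hc, hα]
    rfl
  have hφ (d : G.Dart) : h (R.faceNext d) = h d * κ := by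
    rw [faceNext_apply, hσ, hα, mul_assoc, ← mul_assoc τ, hτ, one_mul]
  have h2 (d : G.Dart) : c (R.apex d) = h d 2 := by
    rw [apex, hc1, hφ]
    rfl
  refine ⟨c, htri, fun d => ?_⟩
  have h3 : c (R.apex d.symm) = h d 3 := by
    rw [h2, hα]
    rfl
  rw [hc, hc1, h2, h3]
  have : ![h d 0, h d 1, h d 2, h d 3] = h d := by
    ext i
    fin_cases i <;> rfl
  rw [this]
  exact (h d).injective

end RotationSystem

/-- For every embedding in the sphere of a finite maximal planar graph (there is one, by planarity),
the graph has a regular 4-coloring if and only if all vertex degrees are multiples of 3. -/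
theorem theorem2 {V : Type*} [Fintype V] (G : SimpleGraph V) [DecidableRel G.Adj]
    (hG : IsMaximalPlanar G) (R : RotationSystem G) (hR : R.IsSpherical) :
    R.R4Colorable ↔ ∀ v : V, 3 ∣ G.degree v := by
  refine ⟨fun h => h.three_dvd_degree, fun hdeg => ?_⟩
  refine hR.r4Colorable (hR.triangular_of_isMaximalPlanar hG fun d hd => ?_) hdeg
  -- A dart fixed by the rotation would leave a vertex of degree 1, which is not a multiple of 3.
  have h1 : (R.rot ^ 1) d = d := by rwa [pow_one]
  have := (hdeg d.fst).trans ((R.rot_pow_apply_eq d 1).1 h1)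
  norm_num at this
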